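/- For integers $k\ge 1$ and $p\ge 0$, let $\mathcal Z_k$ be the up-down (zigzag) poset on $2k$ elements $z_1<z_2>z_3<z_4>\cdots>z_{2k-1}<z_{2k}$ (with $k$ up steps and $k-1$ down steps), whose minimal elements are $z_1,z_3,\dots,z_{2k-1}$. Let $\mathcal C_p(k)$ (respectively $\mathcal A_p(k)$) be the poset on $2k+kp$ elements obtained from $\mathcal Z_k$ by hanging a disjoint copy of a chain (respectively an antichain) of size $p$ below each minimal element: every element of the copy attached to $z_{2i-1}$ lies below $z_{2i-1}$ and hence below every element above $z_{2i-1}$, and there are no further relations except those inside each chain. For a finite poset $P$ with $n$ elements, let $e(P)$ be the number of its linear extensions, i.e. of order-preserving bijections $P\to\{1,\dots,n\}$, and let $\mathrm{Cat}(k)=\frac1{k+1}\binom{2k}{k}$. Then \[\frac{(2k+kp)!}{(p+1)!^k\,(2p+3)^{k-1}\,(p+2)} \;\le\; e(\mathcal C_p(k)) \;\le\; \mathrm{Cat}(k)\cdot\frac{(2k+kp)!}{(p+1)!^k\,(2p+3)^{k-1}\,(p+2)}\] and \[\frac{(2k+kp)!}{(p+1)^k\,(2p+3)^{k-1}\,(p+2)}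 \;\le\; e(\mathcal A_p(k)) \;\le\; \mathrm{Cat}(k)\cdot\frac{(2k+kp)!}{(p+1)^k\,(2p+3)^{k-1}\,(p+2)}.\] -/

import Mathlib

/-- The number `e(P)` of linear extensions of a finite poset `P` with `n` elements: the number of
order-preserving bijections from `P` to an `n`-element chain. -/
noncomputable def numLinearExtensions (P : Type*) [PartialOrder P] : ℕ :=
  Nat.card {f : P ≃ Fin (Nat.card P) // Monotone f}

/-- The elements `z₀, z₁, …, z_{2k-1}` of the up-down poset with `k` up steps and `k - 1` down
steps. -/
@[ext]
structure Zigzag (k : ℕ) where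
  /-- The position of the element along the zigzag. -/
  pos : Fin (2 * k)

namespace Zigzag

/-- The order `z₀ < z₁ > z₂ < z₃ > ⋯ > z_{2k-2} < z_{2k-1}`: the only strict relations are those
of an element in an even position with its neighbours, which lie above it. -/
instance (k : ℕ) : PartialOrder (Zigzag k) where
  le x y := x = y ∨
    (Even (x.pos : ℕ) ∧ ((x.pos : ℕ) + 1 = (y.pos : ℕ) ∨ (y.pos : ℕ) + 1 = (x.pos : ℕ)))
  le_refl x := Or.inl rfl
  le_trans x y z hxy hyz := by
    rcases hxy with rfl | ⟨hx, h⟩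
    · exact hyz
    · rcases hyz with rfl | ⟨hy, h'⟩
      · exact Or.inr ⟨hx, h⟩
      · exfalso
        rw [Nat.even_iff] at hx hy
        omega
  le_antisymm x y hxy hyx := by
    rcases hxy with rfl | ⟨hx, h⟩
    · rfl
    · rcases hyx with rfl | ⟨hy, h'⟩
      · rfl
      · exfalso
        rw [Nat.even_iff] at hx hy
        omega

end Zigzag

/-- The antichain with `p` elements. (The chain with `p` elements is `Fin p`.) -/
@[ext]
structure AntichainPoset (p : ℕ) where
  /-- The index of the element. -/
  idx : Fin p

/-- In an antichain, only equal elements are comparable. -/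
instance (p : ℕ) : PartialOrder (AntichainPoset p) where
  le x y := x = y
  le_refl _ := rfl
  le_trans _ _ _ := Eq.trans
  le_antisymm _ _ h _ := h

/-- The elements of the poset obtained from `Q` by hanging a disjoint copy of `T` below every
minimal element of `Q`. -/
inductive HangFromMin (Q T : Type*) [PartialOrder Q]
  /-- An element of `Q`. -/
  | base (x : Q) : HangFromMin Q T
  /-- The element `t` of the copy of `T` that hangs from the minimal element `m` of `Q`. -/
  | hang (m : Q) (hm : IsMin m) (t : T) : HangFromMin Q T

namespace HangFromMin

variable {Q T : Type*} [PartialOrder Q] [PartialOrder T]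

/-- The order relation: `Q` and the copies of `T` keep their orders, distinct copies are
incomparable, and the copy hanging from `m` lies below `m` and hence below everything above `m`. -/
def le : HangFromMin Q T → HangFromMin Q T → Prop
  | base x, base y => x ≤ y
  | base _, hang _ _ _ => False
  | hang m _ _, base y => m ≤ y
  | hang m _ s, hang m' _ t => m = m' ∧ s ≤ t

instance : PartialOrder (HangFromMin Q T) where
  le := le
  le_refl x := by cases x <;> simp [le]
  le_trans x y z hxy hyz := by
    cases x <;> cases y <;> cases z <;> simp only [le] at hxy hyz ⊢
    · exact le_trans hxy hyz
    · exact le_trans hxy hyz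
    · exact hxy.1 ▸ hyz
    · exact ⟨hxy.1.trans hyz.1, le_trans hxy.2 hyz.2⟩
  le_antisymm x y hxy hyx := by
    cases x <;> cases y <;> simp only [le] at hxy hyx
    · rw [le_antisymm hxy hyx]
    · obtain ⟨rfl, h⟩ := hxy
      rw [le_antisymm h hyx.2]

end HangFromMin

/-- The poset `C_p(k)`: the zigzag with `k - 1` down steps and a chain of size `p` hanging from
each minimal element. -/
abbrev ZigzagChains (p k : ℕ) : Type := HangFromMin (Zigzag k) (Fin p)

/-- The poset `A_p(k)`: the zigzag with `k - 1` down steps and an antichain of size `p` hanging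
from each minimal element. -/
abbrev ZigzagAntichains (p k : ℕ) : Type := HangFromMin (Zigzag k) (AntichainPoset p)

/-! ### Linear extensions of arbitrary finite posets. -/

open Finset

/-! Let d(S) = e(S)/|S|!. Classifying linear extensions by their last element gives |S| d(S) = ∑ d(S
\ x) over maximal x (`card_mul_extensionDensity`), and d is multiplicative over mutually
incomparable parts (`extensionDensity_union`).

Cut the poset into segments of the zigzag with their hanging copies of T, |T| = p. Deleting a peak
splits a segment in two, so the densities satisfy a convolution recursion like Catalan's
(`card_mul_extensionDensity_segment`). Put c = e(T)/(p+1)!. By strong induction, a segment with i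
peaks and i+1 minima has density between c^(i+1)/(2p+3)^i and catalan i times that; these bounds
feed the induction for segments with as many peaks as minima, the whole poset among them. In each
step the lower bound counts the summands and the upper bound uses ∑ catalan j · catalan (n-j) =
catalan (n+1). Only c depends on T: it is 1/(p+1)! for a chain and 1/(p+1) for an antichain. -/

theorem numLinearExtensions_eq_card {P : Type*} [PartialOrder P] {n : ℕ} (h : Nat.card P = n) :
    numLinearExtensions P = Nat.card {f : P ≃ Fin n // Monotone f} := by
  subst h; rfl

theorem numLinearExtensions_congr {P Q : Type*} [PartialOrder P] [PartialOrder Q] (e : P ≃o Q) :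
    numLinearExtensions P = numLinearExtensions Q := by
  rw [numLinearExtensions_eq_card (Nat.card_congr e.toEquiv)]
  refine Nat.card_congr ((Equiv.equivCongr e.toEquiv (Equiv.refl _)).subtypeEquiv fun f => ?_)
  constructor
  · intro hf x y hxy
    exact hf (e.symm.monotone hxy)
  · intro hf x y hxy
    simpa using hf (e.monotone hxy)

theorem numLinearExtensions_of_isEmpty (P : Type*) [PartialOrder P] [IsEmpty P] :
    numLinearExtensions P = 1 := by
  rw [numLinearExtensions_eq_card (Nat.card_of_isEmpty : Nat.card P = 0),
    Nat.card_eq_one_iff_unique]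
  exact ⟨inferInstance, ⟨Equiv.equivOfIsEmpty _ _, fun x => isEmptyElim x⟩⟩

theorem numLinearExtensions_fin (p : ℕ) : numLinearExtensions (Fin p) = 1 := by
  rw [numLinearExtensions_eq_card (Nat.card_fin p), Nat.card_eq_one_iff_unique]
  refine ⟨⟨fun f g => ?_⟩, ⟨Equiv.refl _, monotone_id⟩⟩
  have key (f : {f : Fin p ≃ Fin p // Monotone f}) : StrictMono f.1 :=
    f.2.strictMono_of_injective f.1.injective
  have := Subsingleton.elim ((key f).orderIsoOfSurjective _ f.1.surjective)
    ((key g).orderIsoOfSurjective _ g.1.surjective)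
  ext x
  exact congrArg (fun e : Fin p ≃o Fin p => (e x : ℕ)) this

theorem card_antichainPoset (p : ℕ) : Nat.card (AntichainPoset p) = p := by
  rw [Nat.card_congr (⟨AntichainPoset.idx, AntichainPoset.mk, fun _ => rfl, fun _ => rfl⟩ :
    AntichainPoset p ≃ Fin p), Nat.card_fin]

theorem numLinearExtensions_antichainPoset (p : ℕ) :
    numLinearExtensions (AntichainPoset p) = p.factorial := by
  rw [numLinearExtensions_eq_card (card_antichainPoset p)]
  let i : AntichainPoset p ≃ Fin p :=
    ⟨AntichainPoset.idx, AntichainPoset.mk, fun _ => rfl, fun _ => rfl⟩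
  have hm (f : AntichainPoset p ≃ Fin p) : Monotone f := fun x y (h : x = y) => by rw [h]
  rw [Nat.card_congr (Equiv.subtypeUnivEquiv hm),
    Nat.card_congr (Equiv.equivCongr i (Equiv.refl _)), Nat.card_eq_fintype_card,
    Fintype.card_perm, Fintype.card_fin]

/-- Deleting a maximal element `x` identifies the linear extensions with `x` on top with the linear
extensions of the remaining elements. -/
theorem card_linearExtensions_with_top {P : Type*} [PartialOrder P] [Finite P] {n : ℕ}
    (h : Nat.card P = n + 1) {x : P} (hx : IsMax x) :
    Nat.card {f : {f : P ≃ Fin (n + 1) // Monotone f} // f.1 x = Fin.last n} =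
      numLinearExtensions {y : P // y ≠ x} := by
  classical
  have hc : Nat.card {y : P // y ≠ x} = n := by
    have := Fintype.ofFinite P
    rw [Nat.card_eq_fintype_card] at h ⊢
    rw [Fintype.card_subtype_compl, h]; simp
  rw [numLinearExtensions_eq_card hc]
  have hl (f : {f : {f : P ≃ Fin (n + 1) // Monotone f} // f.1 x = Fin.last n}) (y : P) :
      y ≠ x ↔ f.1.1 y ≠ Fin.last n := by
    rw [not_iff_not, ← f.1.1.injective.eq_iff, f.2]
  refine Nat.card_eq_of_bijective (fun f =>
    ⟨(f.1.1.subtypeEquiv (q := fun z => z ≠ Fin.last n) (hl f)).trans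
      (finSuccAboveOrderIso (Fin.last n)).toEquiv.symm, ?_⟩)
    ⟨?_, ?_⟩
  · intro y z hyz
    exact (finSuccAboveOrderIso (Fin.last n)).symm.monotone (f.1.2 hyz)
  · intro f g hfg
    ext y : 3
    by_cases hy : y = x
    · rw [hy, f.2, g.2]
    · have := congrArg (fun e => e.1 ⟨y, hy⟩) hfg
      simpa using this
  · intro g
    let F : P → Fin (n + 1) := fun y =>
      if hy : y = x then Fin.last n else (g.1 ⟨y, hy⟩).castSucc
    have hF : Function.Injective F := by
      intro y z hyz
      by_cases hy : y = x <;> by_cases hz : z = x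
      · rw [hy, hz]
      · simp only [F, hy, hz, dif_pos, dif_neg, not_false_eq_true] at hyz
        exact absurd hyz.symm (Fin.castSucc_ne_last _)
      · simp only [F, hy, hz, dif_pos, dif_neg, not_false_eq_true] at hyz
        exact absurd hyz (Fin.castSucc_ne_last _)
      · simp only [F, hy, hz, dif_neg, not_false_eq_true] at hyz
        simpa using g.1.injective (Fin.castSucc_injective _ hyz)
    have hm : Monotone F := by
      intro y z hyz
      by_cases hz : z = x
      · simp only [F, hz, dif_pos]; exact Fin.le_last _
      · have hy : y ≠ x := by
          rintro rfl
          exact hz (hx.eq_of_ge hyz)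
        simp only [F, hy, hz, dif_neg, not_false_eq_true]
        exact g.2 (show (⟨y, hy⟩ : {y : P // y ≠ x}) ≤ ⟨z, hz⟩ from hyz)
    refine ⟨⟨⟨Equiv.ofBijective F (hF.bijective_of_nat_card_le (by simp [h])), hm⟩, ?_⟩, ?_⟩
    · simp [F]
    · ext y : 2
      rw [Equiv.trans_apply]
      change (finSuccAboveOrderIso (Fin.last n)).symm _ = _
      rw [OrderIso.symm_apply_eq]
      ext1
      simp [F, y.2, finSuccAboveOrderIso_apply]

-- The linear extensions are fibred by their last element; the fibre over a non-maximal element is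
-- empty.
open Classical in
theorem numLinearExtensions_eq_sum_isMax (P : Type*) [PartialOrder P] [Fintype P] [Nonempty P] :
    numLinearExtensions P =
      ∑ x : P, if IsMax x then numLinearExtensions {y : P // y ≠ x} else 0 := by
  obtain ⟨n, h⟩ : ∃ n, Nat.card P = n + 1 := Nat.exists_eq_succ_of_ne_zero Nat.card_pos.ne'
  rw [numLinearExtensions_eq_card h,
    Nat.card_congr (Equiv.sigmaFiberEquiv
      fun f : {f : P ≃ Fin (n + 1) // Monotone f} => f.1.symm (Fin.last n)).symm,
    Nat.card_sigma]
  refine Finset.sum_congr rfl fun x _ => ?_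
  split_ifs with hx
  · rw [← card_linearExtensions_with_top h hx]
    refine Nat.card_congr (Equiv.subtypeEquivRight fun f => ?_)
    rw [Equiv.symm_apply_eq, eq_comm]
  · rw [Nat.card_eq_zero]
    refine Or.inl ⟨fun f => hx fun y hy => ?_⟩
    have h1 : f.1.1 x = Fin.last n := (Equiv.symm_apply_eq _).1 f.2 |>.symm
    have h2 : f.1.1 y = f.1.1 x := le_antisymm (h1.symm ▸ Fin.le_last (f.1.1 y)) (f.1.2 hy)
    exact (f.1.1.injective h2).le

/-! ### Densities: deletion recursion and multiplicativity. -/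

/-- The proportion of linear extensions of the induced order on `S` among all bijections from `S`
to a chain. -/
noncomputable def extensionDensity {α : Type*} [PartialOrder α] (S : Finset α) : ℚ :=
  (numLinearExtensions S : ℚ) / (S.card.factorial : ℚ)

theorem extensionDensity_empty {α : Type*} [PartialOrder α] :
    extensionDensity (∅ : Finset α) = 1 := by
  simp [extensionDensity, numLinearExtensions_of_isEmpty]

open Classical in
theorem card_mul_extensionDensity {α : Type*} [PartialOrder α] (S : Finset α) :
    (S.card : ℚ) * extensionDensity S =
      ∑ x ∈ S with Maximal (· ∈ S) x, extensionDensity (S.erase x) := by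
  rcases S.eq_empty_or_nonempty with rfl | hS
  · simp
  have : Nonempty S := hS.to_subtype
  obtain ⟨n, hn⟩ : ∃ n, S.card = n + 1 := Nat.exists_eq_succ_of_ne_zero hS.card_ne_zero
  have hmax (x : S) : IsMax x ↔ Maximal (· ∈ S) x.1 :=
    ⟨fun h => ⟨x.2, fun y hy hxy => h (show x ≤ ⟨y, hy⟩ from hxy)⟩,
      fun h y hxy => h.2 y.2 hxy⟩
  have hiso (x : S) : numLinearExtensions {y : S // y ≠ x} =
      numLinearExtensions (S.erase x.1) :=
    numLinearExtensions_congr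
      { toFun := fun y => ⟨y.1.1, mem_erase.2 ⟨fun h => y.2 (Subtype.ext h), y.1.2⟩⟩
        invFun := fun y => ⟨⟨y.1, mem_of_mem_erase y.2⟩,
          fun h => ne_of_mem_erase y.2 (congrArg Subtype.val h)⟩
        left_inv := fun _ => rfl
        right_inv := fun _ => rfl
        map_rel_iff' := Iff.rfl }
  have hsum : numLinearExtensions S =
      ∑ x ∈ S with Maximal (· ∈ S) x, numLinearExtensions (S.erase x) := by
    rw [numLinearExtensions_eq_sum_isMax, sum_filter, ← Finset.sum_coe_sort S]
    refine sum_congr rfl fun x _ => ?_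
    rw [hiso, if_congr (hmax x) rfl rfl]
  have hf : (n.factorial : ℚ) ≠ 0 := by positivity
  rw [extensionDensity, hsum, hn, Nat.factorial_succ, Nat.cast_sum, Finset.sum_div, Finset.mul_sum]
  refine sum_congr rfl fun x hx => ?_
  rw [extensionDensity, card_erase_of_mem (mem_filter.1 hx).1, hn, Nat.add_sub_cancel]
  push_cast
  have : (n + 1 : ℚ) ≠ 0 := by positivity
  field_simp

-- In a uniformly random ordering, the relative orders on two disjoint sets are independent. The
-- proof is by induction on size: the maximal elements of the union are those of the two parts, so
-- both sides obey the same recursion.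
open Classical in
theorem extensionDensity_union {α : Type*} [PartialOrder α] (S T : Finset α)
    (hST : ∀ x ∈ S, ∀ y ∈ T, ¬ x ≤ y ∧ ¬ y ≤ x) :
    extensionDensity (S ∪ T) = extensionDensity S * extensionDensity T := by
  induction hN : (S ∪ T).card generalizing S T with
  | zero =>
    rw [card_eq_zero, union_eq_empty] at hN
    rw [hN.1, hN.2, union_empty, extensionDensity_empty, one_mul]
  | succ N ih =>
    have hd : Disjoint S T := disjoint_left.2 fun x hx hx' => (hST x hx x hx').1 le_rfl
    have hmax : (S ∪ T).filter (Maximal (· ∈ S ∪ T)) =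
        S.filter (Maximal (· ∈ S)) ∪ T.filter (Maximal (· ∈ T)) := by
      ext x
      simp only [mem_filter, mem_union, Maximal]
      grind
    have h1 := card_mul_extensionDensity (S ∪ T)
    rw [hmax, sum_union (disjoint_filter_filter hd),
      sum_congr rfl (g := fun x => extensionDensity (S.erase x) * extensionDensity T),
      sum_congr (s₁ := T.filter _) rfl
        (g := fun x => extensionDensity S * extensionDensity (T.erase x)),
      ← sum_mul, ← mul_sum, ← card_mul_extensionDensity, ← card_mul_extensionDensity,
      card_union_of_disjoint hd] at h1
    · rw [card_union_of_disjoint hd] at hN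
      have : ((S.card + T.card : ℕ) : ℚ) ≠ 0 := by rw [hN]; positivity
      refine mul_left_cancel₀ this ?_
      rw [h1]; push_cast; ring
    · intro x hx
      have hxT := (mem_filter.1 hx).1
      have hxS : x ∉ S := disjoint_right.1 hd hxT
      have he : (S ∪ T).erase x = S ∪ T.erase x := by
        rw [erase_union_distrib, erase_eq_of_notMem hxS]
      rw [he]
      refine ih _ _ (fun y hy z hz => hST y hy z (mem_of_mem_erase hz)) ?_
      rw [← he, card_erase_of_mem (mem_union_right _ hxT), hN, Nat.add_sub_cancel]
    · intro x hx
      have hxS := (mem_filter.1 hx).1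
      have hxT : x ∉ T := disjoint_left.1 hd hxS
      have he : (S ∪ T).erase x = S.erase x ∪ T := by
        rw [erase_union_distrib, erase_eq_of_notMem hxT]
      rw [he]
      refine ih _ _ (fun y hy z hz => hST y (mem_of_mem_erase hy) z hz) ?_
      rw [← he, card_erase_of_mem (mem_union_left _ hxS), hN, Nat.add_sub_cancel]

/-! ### The order in terms of positions along the zigzag. -/

theorem Zigzag.isMin_iff {k : ℕ} (z : Zigzag k) : IsMin z ↔ Even (z.pos : ℕ) := by
  constructor
  · intro h
    by_contra ho
    rw [Nat.not_even_iff] at ho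
    have hlt : (z.pos : ℕ) - 1 < 2 * k := by omega
    have hle : (⟨⟨z.pos - 1, hlt⟩⟩ : Zigzag k) ≤ z :=
      Or.inr ⟨by rw [Nat.even_iff]; dsimp; omega, Or.inl (by dsimp; omega)⟩
    have := congrArg (fun y : Zigzag k => (y.pos : ℕ)) (h.eq_of_le hle)
    dsimp at this
    omega
  · rintro h y (rfl | ⟨hy, hyz⟩)
    · exact le_rfl
    · exfalso
      rw [Nat.even_iff] at h hy
      omega

namespace HangFromMin

instance {Q T : Type*} [PartialOrder Q] [Finite Q] [Finite T] : Finite (HangFromMin Q T) :=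
  Finite.of_surjective
    (fun s : Q ⊕ ({m : Q // IsMin m} × T) =>
      s.elim (base (T := T)) fun mt => hang mt.1.1 mt.1.2 mt.2)
    fun x => by
      cases x with
      | base x => exact ⟨Sum.inl x, rfl⟩
      | hang m hm t => exact ⟨Sum.inr (⟨m, hm⟩, t), rfl⟩

end HangFromMin

instance (k : ℕ) : Finite (Zigzag k) :=
  Finite.of_injective Zigzag.pos fun _ _ h => Zigzag.ext h

namespace HangFromMin

variable {k : ℕ} {T : Type*}

/-- The position along the zigzag; a hanging element has the position of the minimal element that
it hangs from. -/
def position : HangFromMin (Zigzag k) T → ℕ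
  | base z => z.pos
  | hang m _ _ => m.pos

theorem position_base (z : Zigzag k) : (base z : HangFromMin (Zigzag k) T).position = z.pos := rfl

theorem position_lt (x : HangFromMin (Zigzag k) T) : x.position < 2 * k := by
  cases x <;> exact Fin.is_lt _

theorem eq_base_of_odd {x : HangFromMin (Zigzag k) T} (hx : x.position % 2 = 1) :
    x = base ⟨⟨x.position, x.position_lt⟩⟩ := by
  cases x with
  | base z => rfl
  | hang m hm t =>
    rw [Zigzag.isMin_iff, Nat.even_iff] at hm
    change (m.pos : ℕ) % 2 = 1 at hx
    omega

variable [PartialOrder T]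

theorem position_of_le {x y : HangFromMin (Zigzag k) T} (h : x ≤ y) :
    x.position = y.position ∨ (x.position % 2 = 0 ∧
      (x.position + 1 = y.position ∨ y.position + 1 = x.position)) := by
  have key {z w : Zigzag k} (h : z ≤ w) : (z.pos : ℕ) = w.pos ∨ ((z.pos : ℕ) % 2 = 0 ∧
      ((z.pos : ℕ) + 1 = w.pos ∨ (w.pos : ℕ) + 1 = z.pos)) := by
    rcases h with rfl | ⟨h1, h2⟩
    · exact Or.inl rfl
    · exact Or.inr ⟨Nat.even_iff.1 h1, h2⟩
  cases x <;> cases y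
  · exact key h
  · exact h.elim
  · exact key h
  · exact Or.inl (congrArg (fun z : Zigzag k => (z.pos : ℕ)) h.1)

theorem le_base_of_adjacent {x : HangFromMin (Zigzag k) T} {z : Zigzag k}
    (hx : x.position % 2 = 0)
    (h : x.position + 1 = (z.pos : ℕ) ∨ (z.pos : ℕ) + 1 = x.position) : x ≤ base z := by
  cases x <;> exact Or.inr ⟨Nat.even_iff.2 hx, h⟩

theorem le_base_of_position_eq {x : HangFromMin (Zigzag k) T} {z : Zigzag k}
    (h : x.position = (z.pos : ℕ)) : x ≤ base z := by
  cases x <;> exact (Zigzag.ext (Fin.ext h)).le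

variable [Finite T]

/-! ### Segments and their sizes. -/

open Classical in
/-- The elements with position in the interval `[a, b)`. -/
noncomputable def segment (k : ℕ) (T : Type*) [PartialOrder T] [Finite T] (a b : ℕ) :
    Finset (HangFromMin (Zigzag k) T) :=
  haveI := Fintype.ofFinite (HangFromMin (Zigzag k) T)
  {x | a ≤ x.position ∧ x.position < b}

theorem mem_segment {a b : ℕ} {x : HangFromMin (Zigzag k) T} :
    x ∈ segment k T a b ↔ a ≤ x.position ∧ x.position < b := by
  simp [segment]

open Classical in
theorem segment_succ {j : ℕ} (hj : j < k) :
    ∃ R : Finset (HangFromMin (Zigzag k) T), R.card = Nat.card T ∧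
      numLinearExtensions R = numLinearExtensions T ∧ base ⟨⟨2 * j, by omega⟩⟩ ∉ R ∧
      segment k T (2 * j) (2 * j + 1) = insert (base ⟨⟨2 * j, by omega⟩⟩) R := by
  have := Fintype.ofFinite T
  have hm : IsMin (⟨⟨2 * j, by omega⟩⟩ : Zigzag k) :=
    (Zigzag.isMin_iff _).2 (even_two_mul j)
  let i : T ↪ HangFromMin (Zigzag k) T :=
    ⟨hang ⟨⟨2 * j, by omega⟩⟩ hm, fun s t h => by cases h; rfl⟩
  refine ⟨univ.map i, ?_, (numLinearExtensions_congr ⟨(Equiv.ofBijective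
    (fun t => ⟨i t, by simp⟩) ⟨fun s t h => i.injective (congrArg Subtype.val h), ?_⟩), ?_⟩).symm,
    ?_, ?_⟩
  · rw [card_map, Finset.card_univ, Nat.card_eq_fintype_card]
  · rintro ⟨x, hx⟩
    obtain ⟨t, -, rfl⟩ := mem_map.1 hx
    exact ⟨t, rfl⟩
  · intro s t
    exact ⟨fun h => h.2, fun h => ⟨rfl, h⟩⟩
  · intro h
    obtain ⟨t, -, ht⟩ := mem_map.1 h
    cases ht
  · ext x
    rw [mem_segment, mem_insert, mem_map]
    constructor
    · intro h
      have hp : x.position = 2 * j := by omega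
      cases x with
      | base z => exact Or.inl (congrArg base (Zigzag.ext (Fin.ext hp)))
      | hang m hm t =>
        have hm' : m = ⟨⟨2 * j, by omega⟩⟩ := Zigzag.ext (Fin.ext hp)
        refine Or.inr ⟨t, mem_univ _, ?_⟩
        simp only [hm']
        rfl
    · rintro (rfl | ⟨t, -, rfl⟩)
      · simp [position]
      · exact ⟨le_rfl, Nat.lt_succ_self _⟩

open Classical in
theorem segment_union {a b c : ℕ} (hab : a ≤ b) (hbc : b ≤ c) :
    segment k T a b ∪ segment k T b c = segment k T a c := by
  ext x
  simp only [mem_union, mem_segment]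
  omega

theorem card_segment_add {a b c : ℕ} (hab : a ≤ b) (hbc : b ≤ c) :
    (segment k T a c).card = (segment k T a b).card + (segment k T b c).card := by
  classical
  rw [← segment_union hab hbc, card_union_of_disjoint]
  rw [disjoint_left]
  intro x
  simp only [mem_segment]
  omega

theorem card_segment_even_succ {j : ℕ} (hj : j < k) :
    (segment k T (2 * j) (2 * j + 1)).card = Nat.card T + 1 := by
  classical
  obtain ⟨R, hR, -, hmem, heq⟩ := segment_succ (T := T) hj
  rw [heq, card_insert_of_notMem hmem, hR]

theorem card_segment_odd_succ {j : ℕ} (hj : j < k) :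
    (segment k T (2 * j + 1) (2 * j + 2)).card = 1 := by
  rw [card_eq_one]
  refine ⟨base ⟨⟨2 * j + 1, by omega⟩⟩, ?_⟩
  ext x
  rw [mem_segment, mem_singleton]
  constructor
  · intro h
    have hp : x.position = 2 * j + 1 := by omega
    rw [eq_base_of_odd (x := x) (by omega)]
    simp only [hp]
  · rintro rfl
    simp [position]

theorem card_segment_even {a i : ℕ} (h : a + i ≤ k) :
    (segment k T (2 * a) (2 * a + 2 * i)).card = i * (Nat.card T + 2) := by
  induction i with
  | zero =>
    rw [zero_mul, card_eq_zero, eq_empty_iff_forall_notMem]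
    intro x
    rw [mem_segment]
    omega
  | succ i ih =>
    have h1 := card_segment_even_succ (T := T) (show a + i < k by omega)
    have h2 := card_segment_odd_succ (T := T) (show a + i < k by omega)
    rw [mul_add] at h1 h2
    rw [card_segment_add (b := 2 * a + 2 * i) (by omega) (by omega), ih (by omega),
      card_segment_add (b := 2 * a + 2 * i + 1) (by omega) (by omega), h1,
      show 2 * a + 2 * (i + 1) = 2 * a + 2 * i + 2 by ring, h2]
    ring

theorem card_segment_odd {a i : ℕ} (h : a + i < k) :
    (segment k T (2 * a) (2 * a + 2 * i + 1)).card = i * (Nat.card T + 2) + (Nat.card T + 1) := by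
  have h1 := card_segment_even_succ (T := T) h
  rw [mul_add] at h1
  rw [card_segment_add (b := 2 * a + 2 * i) (by omega) (by omega), card_segment_even h.le, h1]

/-! ### Peaks of a segment and the convolution recursion. -/

theorem maximal_mem_segment_iff {a m : ℕ} (hm : 2 * a + 2 ≤ m) (hmk : m ≤ 2 * k)
    {x : HangFromMin (Zigzag k) T} (hx : x ∈ segment k T (2 * a) m) :
    Maximal (· ∈ segment k T (2 * a) m) x ↔ x.position % 2 = 1 := by
  have hx' := mem_segment.1 hx
  constructor
  · intro h
    by_contra ho
    -- An element in an even position lies below both neighbouring peaks; as the segment covers at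
    -- least two positions, one of them belongs to it.
    have key (q : ℕ) (hq : x.position + 1 = q ∨ q + 1 = x.position) (hq' : 2 * a ≤ q ∧ q < m) :
        False := by
      have hle : x ≤ base ⟨⟨q, by omega⟩⟩ := le_base_of_adjacent (by omega) hq
      have := congrArg position (h.eq_of_le ((mem_segment (x := base ⟨⟨q, by omega⟩⟩)).2 hq') hle)
      change x.position = q at this
      omega
    by_cases hq : x.position + 1 < m
    · exact key _ (Or.inl rfl) (by omega)
    · exact key (x.position - 1) (Or.inr (by omega)) (by omega)
  · intro ho
    refine ⟨hx, fun y _ hxy => ?_⟩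
    have hp : x.position = y.position := by
      rcases position_of_le hxy with h | h
      · exact h
      · omega
    rw [eq_base_of_odd ho]
    exact le_base_of_position_eq hp.symm

-- Nothing hangs from a peak, so deleting it empties its position.
open Classical in
theorem segment_erase {a m : ℕ} {x : HangFromMin (Zigzag k) T} (hx : x ∈ segment k T a m)
    (ho : x.position % 2 = 1) :
    (segment k T a m).erase x =
      segment k T a x.position ∪ segment k T (x.position + 1) m := by
  rw [mem_segment] at hx
  ext y
  rw [mem_erase, mem_union, mem_segment, mem_segment, mem_segment]
  have : y ≠ x ↔ y.position ≠ x.position := by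
    refine not_congr ⟨congrArg _, fun h => ?_⟩
    rw [eq_base_of_odd ho, eq_base_of_odd (x := y) (by omega)]
    simp only [h]
  rw [this]
  omega

/-- The two pieces left by a deleted peak are incomparable. The left one always ends at a minimum,
while the right one keeps the end `m`; hence segments of odd length form a closed recursion and
those of even length rely on them. -/
theorem card_mul_extensionDensity_segment {a i m : ℕ} (hi : 1 ≤ i)
    (hm : m = 2 * a + 2 * i ∨ m = 2 * a + 2 * i + 1) (hmk : m ≤ 2 * k) :
    ((segment k T (2 * a) m).card : ℚ) * extensionDensity (segment k T (2 * a) m) =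
      ∑ j ∈ range i, extensionDensity (segment k T (2 * a) (2 * a + 2 * j + 1)) *
        extensionDensity (segment k T (2 * (a + j + 1)) m) := by
  classical
  rw [card_mul_extensionDensity]
  symm
  refine sum_bij (fun j hj => base ⟨⟨2 * a + 2 * j + 1, by have := mem_range.1 hj; omega⟩⟩)
    ?_ ?_ ?_ ?_
  · intro j hj
    have := mem_range.1 hj
    have hmem : base ⟨⟨2 * a + 2 * j + 1, by omega⟩⟩ ∈ segment k T (2 * a) m :=
      mem_segment.2 (by dsimp only [position]; omega)
    rw [mem_filter, maximal_mem_segment_iff (by omega) hmk hmem]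
    exact ⟨hmem, by dsimp only [position]; omega⟩
  · intro j hj j' hj' h
    have := congrArg position h
    dsimp only [position] at this
    omega
  · intro x hx
    rw [mem_filter] at hx
    have ho := (maximal_mem_segment_iff (by omega) hmk hx.1).1 hx.2
    have hx' := mem_segment.1 hx.1
    refine ⟨(x.position - 2 * a) / 2, mem_range.2 (by omega), ?_⟩
    refine Eq.trans ?_ (eq_base_of_odd ho).symm
    congr 3
    omega
  · intro j hj
    have := mem_range.1 hj
    have hmem : base ⟨⟨2 * a + 2 * j + 1, by omega⟩⟩ ∈ segment k T (2 * a) m :=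
      mem_segment.2 (by dsimp only [position]; omega)
    rw [segment_erase hmem (by dsimp only [position]; omega), extensionDensity_union]
    · dsimp only [position]
      congr 3
      ring
    · intro y hy z hz
      rw [mem_segment] at hy hz
      rw [position_base] at hy hz
      dsimp only at hy hz
      exact ⟨fun h => by have := position_of_le h; omega,
        fun h => by have := position_of_le h; omega⟩

/-! ### Bounds on the densities of segments. -/

theorem extensionDensity_segment_even_succ {j : ℕ} (hj : j < k) :
    extensionDensity (segment k T (2 * j) (2 * j + 1)) =
      (numLinearExtensions T : ℚ) / ((Nat.card T + 1).factorial : ℚ) := by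
  classical
  obtain ⟨R, hR, hRT, hmem, heq⟩ := segment_succ (T := T) hj
  have h := card_mul_extensionDensity (segment k T (2 * j) (2 * j + 1))
  have hs : (segment k T (2 * j) (2 * j + 1)).filter
      (Maximal (· ∈ segment k T (2 * j) (2 * j + 1))) = {base ⟨⟨2 * j, by omega⟩⟩} := by
    ext x
    rw [mem_filter, mem_singleton]
    constructor
    · rintro ⟨hx, hmax⟩
      rw [mem_segment] at hx
      exact hmax.eq_of_le (mem_segment.2 (by dsimp only [position]; omega))
        (le_base_of_position_eq (by dsimp only; omega))
    · rintro rfl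
      have hb : base ⟨⟨2 * j, by omega⟩⟩ ∈ segment k T (2 * j) (2 * j + 1) :=
        mem_segment.2 (by dsimp only [position]; omega)
      refine ⟨hb, hb, fun y hy _ => ?_⟩
      replace hy := mem_segment.1 hy
      exact le_base_of_position_eq (by dsimp only; omega)
  rw [hs, sum_singleton, card_segment_even_succ hj] at h
  nth_rewrite 2 [heq] at h
  rw [erase_insert hmem] at h
  have h0 : ((Nat.card T + 1 : ℕ) : ℚ) ≠ 0 := by positivity
  have h1 : ((Nat.card T).factorial : ℚ) ≠ 0 := by positivity
  refine mul_left_cancel₀ h0 (h.trans ?_)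
  rw [extensionDensity, hR, hRT, Nat.factorial_succ]
  push_cast at h0 ⊢
  field_simp

theorem extensionDensity_segment_odd_bounds (i : ℕ) : ∀ a : ℕ, a + i < k →
    ((numLinearExtensions T : ℚ) / ((Nat.card T + 1).factorial : ℚ)) ^ (i + 1) /
        (2 * Nat.card T + 3 : ℚ) ^ i ≤
      extensionDensity (segment k T (2 * a) (2 * a + 2 * i + 1)) ∧
    extensionDensity (segment k T (2 * a) (2 * a + 2 * i + 1)) ≤
      (catalan i : ℚ) *
        (((numLinearExtensions T : ℚ) / ((Nat.card T + 1).factorial : ℚ)) ^ (i + 1) /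
        (2 * Nat.card T + 3 : ℚ) ^ i) := by
  set c : ℚ := (numLinearExtensions T : ℚ) / ((Nat.card T + 1).factorial : ℚ) with hc
  have hc0 : 0 ≤ c := by positivity
  induction i using Nat.strong_induction_on with
  | _ i ih =>
  intro a ha
  rcases i with _ | n
  · have := extensionDensity_segment_even_succ (T := T) ha
    simp only [add_zero] at this
    simp [this, hc]
  set q : ℚ := 2 * Nat.card T + 3 with hq
  have hq0 : 0 < q := by positivity
  have hrec := card_mul_extensionDensity_segment (T := T) (a := a) (i := n + 1)
    (k := k) (m := 2 * a + 2 * (n + 1) + 1) (by omega) (Or.inr rfl) (by omega)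
  rw [card_segment_odd ha] at hrec
  set d := extensionDensity (segment k T (2 * a) (2 * a + 2 * (n + 1) + 1))
  have hterm : ∀ j ∈ range (n + 1), c ^ (n + 2) / q ^ n ≤
        extensionDensity (segment k T (2 * a) (2 * a + 2 * j + 1)) *
          extensionDensity (segment k T (2 * (a + j + 1)) (2 * a + 2 * (n + 1) + 1)) ∧
      extensionDensity (segment k T (2 * a) (2 * a + 2 * j + 1)) *
          extensionDensity (segment k T (2 * (a + j + 1)) (2 * a + 2 * (n + 1) + 1)) ≤
        (catalan j * catalan (n - j) : ℚ) * (c ^ (n + 2) / q ^ n) := by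
    intro j hj
    obtain ⟨l, rfl⟩ := Nat.exists_eq_add_of_le (Nat.lt_succ_iff.1 (mem_range.1 hj))
    obtain ⟨h1, h2⟩ := ih j (by omega) a (by omega)
    obtain ⟨h3, h4⟩ := ih l (by omega) (a + j + 1) (by omega)
    rw [show 2 * (a + j + 1) + 2 * l + 1 = 2 * a + 2 * (j + l + 1) + 1 by ring] at h3 h4
    -- The product of the two bounds does not depend on which peak was deleted.
    have e : c ^ (j + l + 2) / q ^ (j + l) = c ^ (j + 1) / q ^ j * (c ^ (l + 1) / q ^ l) := by
      rw [div_mul_div_comm, ← pow_add, ← pow_add]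
      congr 2
      ring
    rw [Nat.add_sub_cancel_left, e]
    refine ⟨mul_le_mul h1 h3 (by positivity) (le_trans (by positivity) h1),
      (mul_le_mul h2 h4 (le_trans (by positivity) h3) (by positivity)).trans_eq (by ring)⟩
  have hlow := sum_le_sum fun j hj => (hterm j hj).1
  have hup := sum_le_sum fun j hj => (hterm j hj).2
  rw [← hrec, sum_const, card_range, nsmul_eq_mul] at hlow
  rw [← hrec, ← sum_mul] at hup
  have hcat : (∑ j ∈ range (n + 1), (catalan j * catalan (n - j) : ℚ)) = catalan (n + 1) := by
    rw [catalan_succ, Nat.cast_sum, ← Fin.sum_univ_eq_sum_range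
      (fun j => (catalan j * catalan (n - j) : ℚ))]
    simp
  rw [hcat] at hup
  have hw : 0 ≤ c ^ (n + 2) / q ^ n := by positivity
  have hpow : c ^ (n + 1 + 1) / q ^ (n + 1) = c ^ (n + 2) / q ^ n / q := by
    rw [pow_succ q, div_div]
  rw [hpow]
  generalize c ^ (n + 2) / q ^ n = w at *
  have hN : (0 : ℚ) < ((n + 1) * (Nat.card T + 2) + (Nat.card T + 1) : ℕ) := by positivity
  -- The size N satisfies q ≤ N ≤ (n+1)q: the right inequality turns n+1 summands, each at least w,
  -- into the lower bound w/q; the left one gives the upper bound.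
  have hN1 : (((n + 1) * (Nat.card T + 2) + (Nat.card T + 1) : ℕ) : ℚ) ≤ (n + 1 : ℕ) * q := by
    rw [hq]; norm_cast; nlinarith
  have hN2 : q ≤ (((n + 1) * (Nat.card T + 2) + (Nat.card T + 1) : ℕ) : ℚ) := by
    rw [hq]; norm_cast; nlinarith
  generalize (((n + 1) * (Nat.card T + 2) + (Nat.card T + 1) : ℕ) : ℚ) = N at *
  have hu : 0 ≤ w / q := by positivity
  have hwq : w = w / q * q := by field_simp
  constructor
  · refine le_of_mul_le_mul_left (le_trans ?_ hlow) hN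
    nth_rewrite 2 [hwq]
    nlinarith
  · refine le_of_mul_le_mul_left (hup.trans ?_) hN
    nth_rewrite 1 [hwq]
    have : 0 ≤ (catalan (n + 1) : ℚ) * (w / q) := by positivity
    nlinarith

theorem extensionDensity_segment_even_bounds (i : ℕ) : ∀ a : ℕ, a + (i + 1) ≤ k →
    ((numLinearExtensions T : ℚ) / ((Nat.card T + 1).factorial : ℚ)) ^ (i + 1) /
        ((2 * Nat.card T + 3 : ℚ) ^ i * (Nat.card T + 2)) ≤
      extensionDensity (segment k T (2 * a) (2 * a + 2 * (i + 1))) ∧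
    extensionDensity (segment k T (2 * a) (2 * a + 2 * (i + 1))) ≤
      (catalan (i + 1) : ℚ) *
        (((numLinearExtensions T : ℚ) / ((Nat.card T + 1).factorial : ℚ)) ^ (i + 1) /
          ((2 * Nat.card T + 3 : ℚ) ^ i * (Nat.card T + 2))) := by
  have hodd := extensionDensity_segment_odd_bounds (k := k) (T := T)
  set c : ℚ := (numLinearExtensions T : ℚ) / ((Nat.card T + 1).factorial : ℚ) with hc
  have hc0 : 0 ≤ c := by positivity
  set q : ℚ := 2 * Nat.card T + 3 with hq
  set r : ℚ := Nat.card T + 2 with hr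
  have hq0 : 0 < q := by positivity
  have hr0 : 0 < r := by positivity
  have hrq : r ≤ q := by rw [hr, hq]; norm_cast; omega
  induction i using Nat.strong_induction_on with
  | _ n ih =>
  intro a ha
  have hrec := card_mul_extensionDensity_segment (T := T) (a := a) (i := n + 1)
    (k := k) (m := 2 * a + 2 * (n + 1)) (by omega) (Or.inl rfl) (by omega)
  rw [card_segment_even ha] at hrec
  set d := extensionDensity (segment k T (2 * a) (2 * a + 2 * (n + 1)))
  set v := c ^ (n + 1) / (q ^ n * r) with hv
  have hv0 : 0 ≤ v := by positivity
  have hterm : ∀ j ∈ range (n + 1), r * v ≤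
        extensionDensity (segment k T (2 * a) (2 * a + 2 * j + 1)) *
          extensionDensity (segment k T (2 * (a + j + 1)) (2 * a + 2 * (n + 1))) ∧
      extensionDensity (segment k T (2 * a) (2 * a + 2 * j + 1)) *
          extensionDensity (segment k T (2 * (a + j + 1)) (2 * a + 2 * (n + 1))) ≤
        (catalan j * catalan (n - j) : ℚ) * ((n + 1) * r * v) := by
    intro j hj
    obtain ⟨l, rfl⟩ := Nat.exists_eq_add_of_le (Nat.lt_succ_iff.1 (mem_range.1 hj))
    obtain ⟨h1, h2⟩ := hodd j a (by omega)
    rw [Nat.add_sub_cancel_left]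
    -- Deleting the last peak leaves nothing on the right and the reference value is r·v; otherwise
    -- it is q·v. Both lie between r·v and (n+1)·r·v, because q ≤ 2r and n ≥ 1 in the second case.
    rcases l with _ | l
    · have he : segment k T (2 * (a + j + 1)) (2 * a + 2 * (j + 0 + 1)) = ∅ := by
        rw [eq_empty_iff_forall_notMem]
        intro x
        rw [mem_segment]
        omega
      have hvr : c ^ (j + 1) / q ^ j = r * v := by
        rw [hv, add_zero]; field_simp
      rw [hvr] at h1 h2
      rw [he, extensionDensity_empty, mul_one, catalan_zero, Nat.cast_one, mul_one]
      refine ⟨h1, h2.trans (mul_le_mul_of_nonneg_left ?_ (by positivity))⟩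
      rw [mul_assoc]
      exact le_mul_of_one_le_left (by positivity) (by norm_cast; omega)
    · obtain ⟨h3, h4⟩ := ih l (by omega) (a + j + 1) (by omega)
      rw [show 2 * (a + j + 1) + 2 * (l + 1) = 2 * a + 2 * (j + (l + 1) + 1) by ring] at h3 h4
      have e : c ^ (j + 1) / q ^ j * (c ^ (l + 1) / (q ^ l * r)) = q * v := by
        rw [hv]; field_simp; ring
      constructor
      · calc r * v ≤ q * v := mul_le_mul_of_nonneg_right hrq hv0
          _ = _ := e.symm
          _ ≤ _ := mul_le_mul h1 h3 (by positivity) (le_trans (by positivity) h1)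
      · refine (mul_le_mul h2 h4 (le_trans (by positivity) h3) (by positivity)).trans ?_
        rw [mul_mul_mul_comm, e]
        refine mul_le_mul_of_nonneg_left (mul_le_mul_of_nonneg_right ?_ hv0) (by positivity)
        rw [hq, hr]; norm_cast; nlinarith
  have hlow := sum_le_sum fun j hj => (hterm j hj).1
  have hup := sum_le_sum fun j hj => (hterm j hj).2
  rw [← hrec, sum_const, card_range, nsmul_eq_mul] at hlow
  rw [← hrec, ← sum_mul] at hup
  have hcat : (∑ j ∈ range (n + 1), (catalan j * catalan (n - j) : ℚ)) = catalan (n + 1) := by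
    rw [catalan_succ, Nat.cast_sum, ← Fin.sum_univ_eq_sum_range
      (fun j => (catalan j * catalan (n - j) : ℚ))]
    simp
  rw [hcat] at hup
  have hN : (((n + 1) * (Nat.card T + 2) : ℕ) : ℚ) = (n + 1) * r := by
    rw [hr]; push_cast; ring
  rw [hN] at hlow hup
  have hN0 : 0 < (n + 1) * r := by positivity
  constructor
  · refine le_of_mul_le_mul_left (le_trans (le_of_eq ?_) hlow) hN0
    push_cast; ring
  · exact le_of_mul_le_mul_left (hup.trans_eq (by ring)) hN0

/-- The whole poset is the segment of all 2k positions. `D` = 1/c is the only quantity that tells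
chains from antichains. -/
theorem numLinearExtensions_bounds {k : ℕ} (hk : 1 ≤ k) (T : Type*) [PartialOrder T] [Finite T]
    {D : ℚ} (hD : (numLinearExtensions T : ℚ) / ((Nat.card T + 1).factorial : ℚ) = D⁻¹) :
    ((2 * k + k * Nat.card T).factorial : ℚ) /
        (D ^ k * (2 * Nat.card T + 3 : ℚ) ^ (k - 1) * (Nat.card T + 2 : ℚ)) ≤
      (numLinearExtensions (HangFromMin (Zigzag k) T) : ℚ) ∧
    (numLinearExtensions (HangFromMin (Zigzag k) T) : ℚ) ≤
      (catalan k : ℚ) * (((2 * k + k * Nat.card T).factorial : ℚ) /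
        (D ^ k * (2 * Nat.card T + 3 : ℚ) ^ (k - 1) * (Nat.card T + 2 : ℚ))) := by
  obtain ⟨n, rfl⟩ : ∃ n, k = n + 1 := ⟨k - 1, by omega⟩
  have hall (x : HangFromMin (Zigzag (n + 1)) T) :
      x ∈ segment (n + 1) T (2 * 0) (2 * 0 + 2 * (n + 1)) :=
    mem_segment.2 (by have := x.position_lt; omega)
  have hcard := card_segment_even (k := n + 1) (T := T) (a := 0) (i := n + 1) (by omega)
  have hb := extensionDensity_segment_even_bounds (k := n + 1) (T := T) n 0 (by omega)
  rw [extensionDensity, hcard, numLinearExtensions_congr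
    (⟨Equiv.subtypeUnivEquiv hall, Iff.rfl⟩ : segment (n + 1) T (2 * 0) (2 * 0 + 2 * (n + 1)) ≃o
      HangFromMin (Zigzag (n + 1)) T),
    show (n + 1) * (Nat.card T + 2) = 2 * (n + 1) + (n + 1) * Nat.card T by ring, hD] at hb
  have hF : (0 : ℚ) < ((2 * (n + 1) + (n + 1) * Nat.card T).factorial : ℚ) := by positivity
  rw [le_div_iff₀ hF, div_le_iff₀ hF] at hb
  have e : ((2 * (n + 1) + (n + 1) * Nat.card T).factorial : ℚ) /
        (D ^ (n + 1) * (2 * Nat.card T + 3 : ℚ) ^ (n + 1 - 1) * (Nat.card T + 2 : ℚ)) =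
      D⁻¹ ^ (n + 1) / ((2 * Nat.card T + 3 : ℚ) ^ n * (Nat.card T + 2)) *
        ((2 * (n + 1) + (n + 1) * Nat.card T).factorial : ℚ) := by
    rw [Nat.add_sub_cancel, inv_pow, mul_assoc, ← div_div, div_eq_mul_inv _ (D ^ (n + 1))]
    ring
  rw [e, ← mul_assoc]
  exact hb

end HangFromMin

theorem mainTheorem7 (p k : ℕ) (hk : 1 ≤ k) :
    ((Nat.factorial (2 * k + k * p) : ℚ) /
          ((Nat.factorial (p + 1) : ℚ) ^ k * (2 * p + 3 : ℚ) ^ (k - 1) * (p + 2 : ℚ))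
        ≤ (numLinearExtensions (ZigzagChains p k) : ℚ) ∧
      (numLinearExtensions (ZigzagChains p k) : ℚ)
        ≤ (catalan k : ℚ) * ((Nat.factorial (2 * k + k * p) : ℚ) /
          ((Nat.factorial (p + 1) : ℚ) ^ k * (2 * p + 3 : ℚ) ^ (k - 1) * (p + 2 : ℚ)))) ∧
    ((Nat.factorial (2 * k + k * p) : ℚ) /
          ((p + 1 : ℚ) ^ k * (2 * p + 3 : ℚ) ^ (k - 1) * (p + 2 : ℚ))
        ≤ (numLinearExtensions (ZigzagAntichains p k) : ℚ) ∧
      (numLinearExtensions (ZigzagAntichains p k) : ℚ)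
        ≤ (catalan k : ℚ) * ((Nat.factorial (2 * k + k * p) : ℚ) /
          ((p + 1 : ℚ) ^ k * (2 * p + 3 : ℚ) ^ (k - 1) * (p + 2 : ℚ)))) := by
  have : Finite (AntichainPoset p) :=
    Finite.of_injective AntichainPoset.idx fun _ _ h => AntichainPoset.ext h
  constructor
  · have h := HangFromMin.numLinearExtensions_bounds hk (Fin p) (D := (p + 1).factorial)
      (by rw [numLinearExtensions_fin, Nat.card_fin, Nat.cast_one, one_div])
    rwa [Nat.card_fin] at h
  · have h := HangFromMin.numLinearExtensions_bounds hk (AntichainPoset p) (D := p + 1) (by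
      rw [numLinearExtensions_antichainPoset, card_antichainPoset, Nat.factorial_succ]
      push_cast
      field_simp)
    rwa [card_antichainPoset] at h
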